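/- Let $(X,d)$ be a proper metric space with base point $x_0$, and write $|x|=d(x,x_0)$ for $x\in X$; the base point of $\mathbf R^{m}$ (with the Euclidean metric) is $0$. A continuous $s\colon\mathbf R_+\to\mathbf R_+$ is asymptotically sublinear if for each $c>0$ there is $M$ with $s(r)\le cr+M$ for all $r$. A continuous $f\colon X\to\mathbf R$ is Higson sublinear if for each asymptotically sublinear $s$ and all sequences with $|x_k|,|y_k|\to\infty$ and $d(x_k,y_k)\le s(|x_k|)$ for all $k$ one has $|f(x_k)-f(y_k)|\to 0$. Let $h_L(X)$ be the compactification of $X$ determined by the bounded Higson sublinear functions $X\to\mathbf R$ (the closure of the image of $X$ under the evaluation map into the product of lines indexed by these functions), let $\nu_L(X)=h_L(X)\setminus X$ be the sublinear Higson corona, and let $\dim$ be the Lebesgue covering dimension, with $\dim\emptyset=-1$. For $A\subset X$, a (not necessarily continuous) function $f\colon A\to\mathbf R^{n+1}$ is a morphism of Dranishnikov's category $\tilde{\mathcal A}$ if it is asymptotically Lipschitz, i.e. $|f(x)-f(y)|\le\lambda d(x,y)+M$ for all $x,y\in A$ and some $\lambda,M\ge0$, and there are $b,c>0$ with $|f(x)|\ge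 c|x|-b$ for all $x\in A$. The space $\mathbf R^{n+1}$ is an absolute extensor of $X$ in $\tilde{\mathcal A}$ if every morphism $A\to\mathbf R^{n+1}$ with $A$ closed in $X$ extends to a morphism $X\to\mathbf R^{n+1}$. Then for every integer $n\ge0$, $\dim\nu_L(X)\le n$ if and only if $\mathbf R^{n+1}$ is an absolute extensor of $X$ in $\tilde{\mathcal A}$. Moreover, if $X$ is unbounded, then $\dim\nu_L(X)$ is the smallest integer $n\ge0$ such that $\mathbf R^{n+1}$ is an absolute extensor of $X$ in $\tilde{\mathcal A}$ (and $\dim\nu_L(X)=\infty$ if there is no such $n$). -/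

import Mathlib

open Filter Topology Set
open scoped NNReal

namespace SublinearHigson

/-! ### Covering dimension -/

/-- Every finite open cover of `T` has a finite open refinement (again a cover of `T`) such that
every point lies in at most `n + 1` of its members. -/
def CoveringDimLE (T : Type*) [TopologicalSpace T] (n : ℕ) : Prop :=
  ∀ 𝒰 : Set (Set T), 𝒰.Finite → (∀ U ∈ 𝒰, IsOpen U) → ⋃₀ 𝒰 = univ →
    ∃ 𝒱 : Set (Set T), 𝒱.Finite ∧ (∀ V ∈ 𝒱, IsOpen V) ∧ ⋃₀ 𝒱 = univ ∧
      (∀ V ∈ 𝒱, ∃ U ∈ 𝒰, V ⊆ U) ∧ ∀ t : T, {V ∈ 𝒱 | t ∈ V}.encard ≤ n + 1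

open Classical in
/-- The Lebesgue covering dimension. The empty space has dimension `⊥` (that is, `-1`), and the
dimension is `⊤` (that is, `∞`) if `CoveringDimLE T n` fails for all `n`. -/
noncomputable def coveringDim (T : Type*) [TopologicalSpace T] : WithBot ℕ∞ :=
  if IsEmpty T then ⊥ else sInf {d | ∃ n : ℕ, d = (n : WithBot ℕ∞) ∧ CoveringDimLE T n}

/-! ### The sublinear Higson corona -/

/-- A continuous function `s : ℝ₊ → ℝ₊` is asymptotically sublinear if for each slope `c > 0`
there is `M` with `s r ≤ c * r + M` for all `r`. -/
def AsymptoticallySublinear (s : ℝ≥0 → ℝ≥0) : Prop :=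
  Continuous s ∧ ∀ c : ℝ≥0, 0 < c → ∃ M : ℝ≥0, ∀ r : ℝ≥0, s r ≤ c * r + M

/-- Higson sublinear functions on the metric space `X` with base point `x₀`; the norm of `x` is
its distance from `x₀`, and `x n → ∞` means that the norm of `x n` tends to infinity. -/
def HigsonSublinear {X Y : Type*} [MetricSpace X] [MetricSpace Y] (x₀ : X) (f : X → Y) : Prop :=
  Continuous f ∧
    ∀ s : ℝ≥0 → ℝ≥0, AsymptoticallySublinear s →
      ∀ x y : ℕ → X,
        Tendsto (fun n => dist (x n) x₀) atTop atTop →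
        Tendsto (fun n => dist (y n) x₀) atTop atTop →
        (∀ n, dist (x n) (y n) ≤ s (nndist (x n) x₀)) →
        Tendsto (fun n => dist (f (x n)) (f (y n))) atTop (𝓝 0)

/-- The set of bounded real-valued Higson sublinear functions on `X`. -/
def BoundedHigson {X : Type*} [MetricSpace X] (x₀ : X) : Type _ :=
  {f : X → ℝ // HigsonSublinear x₀ f ∧ ∃ C : ℝ, ∀ x, |f x| ≤ C}

/-- The evaluation map of `X` into the product of lines indexed by the bounded Higson sublinear
functions. -/
def higsonEval {X : Type*} [MetricSpace X] (x₀ : X) : X → (BoundedHigson x₀ → ℝ) :=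
  fun x f => f.1 x

/-- The Higson sublinear compactification `h_L(X)`: the closure of the image of `X` under the
evaluation map, with the topology of pointwise convergence. It is the compactification of `X` to
which exactly the bounded Higson sublinear functions extend continuously. -/
def higsonCompactification {X : Type*} [MetricSpace X] (x₀ : X) : Set (BoundedHigson x₀ → ℝ) :=
  closure (range (higsonEval x₀))

/-- The sublinear Higson corona `ν_L(X) = h_L(X) \ X`. -/
def higsonCorona {X : Type*} [MetricSpace X] (x₀ : X) : Set (BoundedHigson x₀ → ℝ) :=
  higsonCompactification x₀ \ range (higsonEval x₀)

/-! ### Absolute extensors in the category `Ã` -/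

/-- `f` restricted to `A` is asymptotically Lipschitz. -/
def AsymptoticallyLipschitzOn {X Y : Type*} [MetricSpace X] [MetricSpace Y]
    (f : X → Y) (A : Set X) : Prop :=
  ∃ l M : ℝ, 0 ≤ l ∧ 0 ≤ M ∧ ∀ x ∈ A, ∀ y ∈ A, dist (f x) (f y) ≤ l * dist x y + M

/-- `f` restricted to the subspace `A` of the pointed space `(X, x₀)` is a morphism of `Ã` into
the pointed space `(Y, y₀)`; norms are distances from the base points. -/
def IsMorphismOn {X Y : Type*} [MetricSpace X] [MetricSpace Y]
    (x₀ : X) (y₀ : Y) (f : X → Y) (A : Set X) : Prop :=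
  AsymptoticallyLipschitzOn f A ∧
    ∃ b c : ℝ, 0 < b ∧ 0 < c ∧ ∀ x ∈ A, c * dist x x₀ - b ≤ dist (f x) y₀

/-- `(Y, y₀)` is an absolute extensor of `(X, x₀)` in `Ã`: every morphism defined on a closed
subset `A` of `X` extends to a morphism defined on `X`. -/
def IsAbsoluteExtensor {X Y : Type*} [MetricSpace X] [MetricSpace Y] (x₀ : X) (y₀ : Y) : Prop :=
  ∀ A : Set X, IsClosed A → ∀ f : X → Y, IsMorphismOn x₀ y₀ f A →
    ∃ g : X → Y, IsMorphismOn x₀ y₀ g univ ∧ EqOn g f A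

end SublinearHigson

namespace SublinearHigson

/-! ### Covering dimension of compact Hausdorff spaces -/

/-! A Lipschitz map divided by `1 + |x|` is bounded and oscillates little on balls of radius `δ|x|`,
so it extends continuously to `h_L(X)`. Conversely, for `ψ` bounded and slowly oscillating, `|x| ψ`
lies within `ε|x|` of a Lipschitz map. Up to small relative error, Lipschitz maps `X → ℝⁿ⁺¹` are
thus continuous maps on the corona, and linear growth means having no zeros there. The theorem
becomes the classical characterisation of `dim ≤ n` for compact Hausdorff spaces by maps into `ℝⁿ⁺¹`
avoiding zero.

If `dim ≤ n`, zero is an unstable value, so a Lipschitz approximation `F` of a given morphism on `A`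
has a linearly growing map `G` nearby (`exists_growing_lipschitz_near`). Adding to `F` the
difference `G - F`, truncated at a multiple of the distance to `A`, leaves `F` unchanged on `A` and
keeps the growth.

Conversely, a map on the corona without zeros on a closed set gives a morphism on a closed part of
`X`. Extending it and dividing by the norm gives a zero-free map on the corona, which is glued to
the original one; `coveringDimLE_of_extension` then bounds the dimension. -/

theorem CoveringDimLE.mono {T : Type*} [TopologicalSpace T] {m n : ℕ} (h : CoveringDimLE T m)
    (hmn : m ≤ n) : CoveringDimLE T n := by
  intro 𝒰 hfin hopen hcov
  obtain ⟨𝒱, h1, h2, h3, h4, h5⟩ := h 𝒰 hfin hopen hcov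
  refine ⟨𝒱, h1, h2, h3, h4, fun t => (h5 t).trans ?_⟩
  gcongr

theorem coveringDim_le_iff {T : Type*} [TopologicalSpace T] (n : ℕ) :
    coveringDim T ≤ (n : WithBot ℕ∞) ↔ CoveringDimLE T n := by
  unfold coveringDim
  split_ifs with hT
  · refine ⟨fun _ => ?_, fun _ => bot_le⟩
    intro 𝒰 _ _ _
    exact ⟨∅, finite_empty, by simp, by ext t; exact hT.elim t, by simp, fun t => hT.elim t⟩
  · constructor
    · intro h
      have hlt : sInf {d : WithBot ℕ∞ | ∃ n : ℕ, d = (n : WithBot ℕ∞) ∧ CoveringDimLE T n} <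
          ((n + 1 : ℕ) : WithBot ℕ∞) := lt_of_le_of_lt h (by exact_mod_cast Nat.lt_succ_self n)
      obtain ⟨d, ⟨m, rfl, hm⟩, hd⟩ := sInf_lt_iff.1 hlt
      have : m < n + 1 := by exact_mod_cast hd
      exact hm.mono (by omega)
    · intro h
      exact sInf_le ⟨n, rfl, h⟩

/-- Finitely many points of an `n`-dimensional space can be moved by less than `ε` so that any
`n` of them become linearly independent. -/
theorem exists_linearIndepOn_near {E ι : Type*} [NormedAddCommGroup E] [NormedSpace ℝ E]
    [FiniteDimensional ℝ E] (c : ι → E) {ε : ℝ} (hε : 0 < ε) (s : Finset ι) :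
    ∃ p : ι → E, (∀ i, dist (p i) (c i) < ε) ∧
      ∀ t : Finset ι, t ⊆ s → t.card ≤ Module.finrank ℝ E → LinearIndepOn ℝ p (t : Set ι) := by
  classical
  induction s using Finset.induction_on with
  | empty =>
    refine ⟨c, fun i => by simpa using hε, fun t ht _ => ?_⟩
    rw [Finset.subset_empty.1 ht, Finset.coe_empty]
    exact linearIndepOn_empty ℝ c
  | insert a s ha ih =>
    obtain ⟨p, hp, hind⟩ := ih
    let _ : MeasurableSpace E := borel E
    have : BorelSpace E := ⟨rfl⟩
    let μ : MeasureTheory.Measure E := MeasureTheory.Measure.addHaar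
    -- Spans of fewer than `finrank` points are proper subspaces, hence null; finitely many cannot
    -- cover a ball, so a new point can be chosen off all of them.
    have hnull : μ (⋃ t ∈ {t ∈ s.powerset | t.card < Module.finrank ℝ E},
        (Submodule.span ℝ (p '' (t : Set ι)) : Set E)) = 0 := by
      refine (MeasureTheory.measure_biUnion_null_iff (Finset.countable_toSet _)).2 fun t ht => ?_
      apply MeasureTheory.Measure.addHaar_submodule
      intro htop
      have hcard : (t.image p).card ≤ t.card := Finset.card_image_le
      have h1 : Module.finrank ℝ (Submodule.span ℝ ((t.image p : Finset E) : Set E)) ≤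
          (t.image p).card := finrank_span_finset_le_card _
      rw [Finset.coe_image, htop, finrank_top] at h1
      have := (Finset.mem_filter.1 ht).2
      omega
    have hpos : 0 < μ (Metric.ball (c a) ε) := Metric.measure_ball_pos μ _ hε
    obtain ⟨q, hq, hq'⟩ : ∃ q ∈ Metric.ball (c a) ε,
        q ∉ ⋃ t ∈ {t ∈ s.powerset | t.card < Module.finrank ℝ E},
          (Submodule.span ℝ (p '' (t : Set ι)) : Set E) := by
      by_contra! hcon
      exact hpos.ne' (MeasureTheory.measure_mono_null hcon hnull)
    have heq : ∀ t : Set ι, a ∉ t → EqOn p (Function.update p a q) t := fun t hat i hi => by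
      rw [Function.update_of_ne]
      rintro rfl
      exact hat hi
    refine ⟨Function.update p a q, fun i => ?_, fun t ht hcard => ?_⟩
    · by_cases hi : i = a
      · subst hi
        simpa using hq
      · simpa [Function.update_of_ne hi] using hp i
    · by_cases hat : a ∈ t
      · have hsub : t.erase a ⊆ s := fun i hi => by
          obtain ⟨hne, hit⟩ := Finset.mem_erase.1 hi
          exact (Finset.mem_insert.1 (ht hit)).resolve_left hne
        have hlt : (t.erase a).card < Module.finrank ℝ E :=
          (Finset.card_erase_lt_of_mem hat).trans_le hcard
        have hna : a ∉ ((t.erase a : Finset ι) : Set ι) := by simp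
        rw [← Finset.insert_erase hat, Finset.coe_insert, linearIndepOn_insert hna]
        refine ⟨(hind _ hsub hlt.le).congr (heq _ hna), ?_⟩
        rw [← (heq _ hna).image_eq, Function.update_self]
        simp only [mem_iUnion, not_exists] at hq'
        exact hq' (t.erase a) (Finset.mem_filter.2 ⟨Finset.mem_powerset.2 hsub, hlt⟩)
      · have hsub : t ⊆ s := fun i hi =>
          (Finset.mem_insert.1 (ht hi)).resolve_left (fun h => hat (h ▸ hi))
        exact (hind t hsub hcard).congr (heq _ (by simpa using hat))

/-- On a compact Hausdorff space of covering dimension at most `n`, zero is an unstable value of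
every continuous map into an `(n + 1)`-dimensional space. -/
theorem CoveringDimLE.exists_nowhere_zero_near {T E : Type*} [TopologicalSpace T] [CompactSpace T]
    [T2Space T] [NormedAddCommGroup E] [NormedSpace ℝ E] [FiniteDimensional ℝ E] {n : ℕ}
    (hdim : CoveringDimLE T n) (hE : Module.finrank ℝ E = n + 1) (u : C(T, E)) {ε : ℝ}
    (hε : 0 < ε) : ∃ v : C(T, E), (∀ t, dist (v t) (u t) < ε) ∧ ∀ t, v t ≠ 0 := by
  classical
  obtain ⟨s, hs⟩ := CompactSpace.elim_nhds_subcover (fun t : T => u ⁻¹' Metric.ball (u t) (ε / 2))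
    (fun t => u.continuous.continuousAt (Metric.ball_mem_nhds _ (by positivity)))
  obtain ⟨𝒱, hfin, hopen, hcov, href, hord⟩ := hdim
    ((fun t : T => u ⁻¹' Metric.ball (u t) (ε / 2)) '' s) (s.finite_toSet.image _)
    (by rintro _ ⟨t, -, rfl⟩; exact Metric.isOpen_ball.preimage u.continuous)
    (by rw [sUnion_image]; exact hs)
  have : Fintype 𝒱 := hfin.fintype
  have hcen : ∀ V : 𝒱, ∃ y : E, ∀ t ∈ (V : Set T), dist (u t) y < ε / 2 := fun V => by
    obtain ⟨_, ⟨t, -, rfl⟩, hVU⟩ := href V V.2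
    exact ⟨u t, fun t' ht' => hVU ht'⟩
  choose c hc using hcen
  obtain ⟨p, hp, hind⟩ := exists_linearIndepOn_near c (half_pos hε) Finset.univ
  obtain ⟨φ, hφ⟩ := PartitionOfUnity.exists_isSubordinate (isClosed_univ : IsClosed (univ : Set T))
    (fun V : 𝒱 => (V : Set T)) (fun V => hopen V V.2)
    (by rw [← sUnion_eq_iUnion, hcov])
  have hmem : ∀ V t, φ V t ≠ 0 → t ∈ (V : Set T) := fun V t h =>
    hφ V (subset_tsupport _ h)
  have hsum : ∀ t, ∑ V, φ V t = 1 := fun t => by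
    rw [← finsum_eq_sum_of_fintype]
    exact φ.sum_eq_one (mem_univ t)
  refine ⟨⟨fun t => ∑ V, φ V t • p V, by fun_prop⟩, fun t => ?_, fun t h0 => ?_⟩
  · have hrep : (∑ V, φ V t • p V) - u t = ∑ V, φ V t • (p V - u t) := by
      simp only [smul_sub, Finset.sum_sub_distrib]
      rw [← Finset.sum_smul, hsum, one_smul]
    have hne : ∃ V, φ V t ≠ 0 := by
      by_contra! hall
      simpa [hall] using hsum t
    obtain ⟨V₀, hV₀⟩ := hne
    have hbound : ∀ V, φ V t ≠ 0 → ‖p V - u t‖ < ε := fun V hV => by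
      rw [← dist_eq_norm]
      have h1 := hp V
      have h2 := hc V t (hmem V t hV)
      rw [dist_comm] at h2
      linarith [dist_triangle (p V) (c V) (u t)]
    change dist (∑ V, φ V t • p V) (u t) < ε
    rw [dist_eq_norm, hrep]
    calc ‖∑ V, φ V t • (p V - u t)‖ ≤ ∑ V, φ V t * ‖p V - u t‖ :=
          (norm_sum_le _ _).trans_eq (Finset.sum_congr rfl fun V _ => by
            rw [norm_smul, Real.norm_of_nonneg (φ.nonneg V t)])
      _ < ∑ V, φ V t * ε := by
          refine Finset.sum_lt_sum (fun V _ => ?_) ⟨V₀, Finset.mem_univ _, ?_⟩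
          · by_cases hV : φ V t = 0
            · simp [hV]
            · exact mul_le_mul_of_nonneg_left (hbound V hV).le (φ.nonneg V t)
          · exact mul_lt_mul_of_pos_left (hbound V₀ hV₀)
              ((φ.nonneg V₀ t).lt_of_ne hV₀.symm)
      _ = ε := by rw [← Finset.sum_mul, hsum, one_mul]
  -- At most `n + 1` weights are nonzero at `t`, and their vectors are independent; a zero would
  -- make all weights vanish although they sum to 1.
  · let S : Finset 𝒱 := {V | φ V t ≠ 0}
    have hScard : S.card ≤ n + 1 := by
      have hsub : (S.map (Function.Embedding.subtype _) : Set (Set T)) ⊆ {V ∈ 𝒱 | t ∈ V} := by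
        intro V hV
        simp only [Finset.coe_map, mem_image, Finset.mem_coe] at hV
        obtain ⟨W, hW, rfl⟩ := hV
        exact ⟨W.2, hmem W t (Finset.mem_filter.1 hW).2⟩
      have := (encard_le_encard hsub).trans (hord t)
      rw [encard_coe_eq_coe_finsetCard, Finset.card_map] at this
      exact_mod_cast this
    have hlin := linearIndepOn_finset_iff.1 (hind S (Finset.subset_univ _) (by omega))
      (fun V => φ V t) (by
        rw [← h0]
        exact Finset.sum_subset (Finset.subset_univ _) fun V _ hV => by
          have : φ V t = 0 := by simpa [S] using hV
          rw [this, zero_smul])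
    have hall : ∀ V, φ V t = 0 := fun V => by
      by_contra hV
      exact hV (hlin V (by simpa [S] using hV))
    simpa [hall] using hsum t

/-- Every open cover with `n + 2` members has an open shrinking with empty intersection. -/
def HasEmptyShrinkings (T : Type*) [TopologicalSpace T] (n : ℕ) : Prop :=
  ∀ U : Fin (n + 2) → Set T, (∀ i, IsOpen (U i)) → ⋃ i, U i = univ →
    ∃ W : Fin (n + 2) → Set T, (∀ i, IsOpen (W i)) ∧ ⋃ i, W i = univ ∧ (∀ i, W i ⊆ U i) ∧
      ⋂ i, W i = ∅

/-- The sets `S` are treated one at a time. Adjoining the union of the members outside `S` to each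
member in `S` gives a cover with `n + 2` sets; its shrinking cuts down the members in `S` and leaves
the others alone. Later shrinkings preserve what was achieved. -/
theorem HasEmptyShrinkings.exists_shrinking {T ι : Type*} [TopologicalSpace T] {n : ℕ}
    (hT : HasEmptyShrinkings T n) (U : ι → Set T) (hU : ∀ i, IsOpen (U i))
    (hcov : ⋃ i, U i = univ) (𝒮 : Finset (Finset ι)) :
    ∃ V : ι → Set T, (∀ i, IsOpen (V i)) ∧ ⋃ i, V i = univ ∧ (∀ i, V i ⊆ U i) ∧
      ∀ S ∈ 𝒮, S.card = n + 2 → ∀ t, ∃ i ∈ S, t ∉ V i := by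
  classical
  induction 𝒮 using Finset.induction_on with
  | empty => exact ⟨U, hU, hcov, fun _ => Subset.rfl, by simp⟩
  | insert S 𝒮 _ ih =>
    obtain ⟨V, hVo, hVc, hVU, hVS⟩ := ih
    by_cases hS : S.card = n + 2
    swap
    · refine ⟨V, hVo, hVc, hVU, fun S' hS' hcard => ?_⟩
      rcases Finset.mem_insert.1 hS' with rfl | h
      · exact absurd hcard hS
      · exact hVS S' h hcard
    let e : Fin (n + 2) ≃ S := (S.equivFinOfCardEq hS).symm
    have hVc' : ∀ t, ∃ i, t ∈ V i := fun t => mem_iUnion.1 (hVc ▸ mem_univ t)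
    obtain ⟨W, hWo, hWc, hWU, hWe⟩ := hT (fun j => V (e j) ∪ ⋃ i, ⋃ (_ : i ∉ S), V i)
      (fun j => (hVo _).union (isOpen_iUnion fun i => isOpen_iUnion fun _ => hVo i)) (by
        refine eq_univ_of_forall fun t => ?_
        obtain ⟨i, hi⟩ := hVc' t
        by_cases hiS : i ∈ S
        · refine mem_iUnion.2 ⟨e.symm ⟨i, hiS⟩, Or.inl ?_⟩
          simpa using hi
        · exact mem_iUnion.2 ⟨0, Or.inr (mem_iUnion₂.2 ⟨i, hiS, hi⟩)⟩)
    refine ⟨fun i => V i ∩ ⋂ (j : Fin (n + 2)), ⋂ (_ : (e j : ι) = i), W j,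
      fun i => (hVo i).inter (isOpen_iInter_of_finite fun j =>
        isOpen_iInter_of_finite fun _ => hWo j), ?_, fun i => inter_subset_left.trans (hVU i), ?_⟩
    · refine eq_univ_of_forall fun t => ?_
      obtain ⟨j, hj⟩ := mem_iUnion.1 (hWc ▸ mem_univ t)
      rcases hWU j hj with h | h
      · refine mem_iUnion.2 ⟨e j, h, mem_iInter₂.2 fun j' hj' => ?_⟩
        rwa [e.injective (Subtype.ext hj')]
      · obtain ⟨i, hiS, hi⟩ := mem_iUnion₂.1 h
        exact mem_iUnion.2 ⟨i, hi, mem_iInter₂.2 fun j' hj' => absurd (hj' ▸ (e j').2) hiS⟩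
    · intro S' hS' hcard t
      rcases Finset.mem_insert.1 hS' with rfl | h
      · have : t ∉ ⋂ i, W i := by simp [hWe]
        obtain ⟨j, hj⟩ := not_forall.1 (fun h => this (mem_iInter.2 h))
        exact ⟨e j, (e j).2, fun h => hj (mem_iInter₂.1 h.2 j rfl)⟩
      · obtain ⟨i, hi, hti⟩ := hVS S' h hcard t
        exact ⟨i, hi, fun h => hti h.1⟩

theorem HasEmptyShrinkings.coveringDimLE {T : Type*} [TopologicalSpace T] {n : ℕ}
    (hT : HasEmptyShrinkings T n) : CoveringDimLE T n := by
  classical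
  intro 𝒰 hfin hopen hcov
  have : Fintype 𝒰 := hfin.fintype
  obtain ⟨V, hVo, hVc, hVU, hVS⟩ := hT.exists_shrinking (fun U : 𝒰 => (U : Set T))
    (fun U => hopen U U.2) (by rw [← sUnion_eq_iUnion, hcov]) Finset.univ
  refine ⟨range V, finite_range V, by rintro _ ⟨i, rfl⟩; exact hVo i, by rw [sUnion_range, hVc],
    by rintro _ ⟨i, rfl⟩; exact ⟨i, i.2, hVU i⟩, fun t => ?_⟩
  have hsub : {W ∈ range V | t ∈ W} ⊆ V '' (({i | t ∈ V i} : Finset 𝒰) : Set 𝒰) := by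
    rintro _ ⟨⟨i, rfl⟩, hi⟩
    exact ⟨i, by simpa using hi, rfl⟩
  refine (encard_le_encard hsub).trans ((encard_image_le _ _).trans ?_)
  rw [encard_coe_eq_coe_finsetCard]
  by_contra! hlt
  have hlt' : n + 1 < ({i | t ∈ V i} : Finset 𝒰).card := by exact_mod_cast hlt
  obtain ⟨S, hS, hScard⟩ := Finset.exists_subset_card_eq (Nat.succ_le_of_lt hlt')
  obtain ⟨i, hi, hti⟩ := hVS S (Finset.mem_univ _) hScard t
  exact hti (Finset.mem_filter.1 (hS hi)).2

/-- If continuous maps into `ℝⁿ⁺¹` without zeros on a closed set can be modified off that set so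
as to have no zeros at all, then the covering dimension is at most `n`. -/
theorem coveringDimLE_of_extension {T : Type*} [TopologicalSpace T] [NormalSpace T] {n : ℕ}
    (hext : ∀ h : C(T, Fin (n + 1) → ℝ), ∀ A : Set T, IsClosed A → (∀ t ∈ A, h t ≠ 0) →
      ∃ h' : C(T, Fin (n + 1) → ℝ), EqOn h' h A ∧ ∀ t, h' t ≠ 0) : CoveringDimLE T n := by
  refine HasEmptyShrinkings.coveringDimLE fun U hU hcov => ?_
  obtain ⟨φ, hφ⟩ := PartitionOfUnity.exists_isSubordinate_of_locallyFinite
    (isClosed_univ : IsClosed (univ : Set T)) U hU (locallyFinite_of_finite _) hcov.ge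
  have hsum : ∀ t, ∑ i, φ i t = 1 := fun t => by
    rw [← finsum_eq_sum_of_fintype]
    exact φ.sum_eq_one (mem_univ t)
  -- A common zero of these differences makes all `φ i` equal, hence none of them zero as they sum
  -- to 1. So there are no zeros where some `φ i` vanishes.
  obtain ⟨h', hEq, hne⟩ := hext
    ⟨fun t i => φ i.castSucc t - φ (Fin.last _) t, by fun_prop⟩ (⋃ i, {t | φ i t = 0})
    (isClosed_iUnion_of_finite fun i => isClosed_eq (φ i).continuous continuous_const) (by
      intro t ht h0
      obtain ⟨i, hi⟩ := mem_iUnion.1 ht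
      have hlast : ∀ j, φ j t = φ (Fin.last _) t := fun j => by
        refine Fin.lastCases rfl (fun j => ?_) j
        exact sub_eq_zero.1 (congrFun h0 j)
      have hall : ∀ j, φ j t = 0 := fun j => by rw [hlast j, ← hlast i, hi]
      simpa [hall] using hsum t)
  let g : Fin (n + 2) → T → ℝ := fun i t => Fin.snoc (α := fun _ => ℝ) (h' t) 0 i
  have hgc : ∀ (i : Fin (n + 1)) t, g i.castSucc t = h' t i := fun i t => Fin.snoc_castSucc ..
  have hgl : ∀ t, g (Fin.last _) t = 0 := fun t => Fin.snoc_last ..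
  have hgcont : ∀ i, Continuous (g i) := fun i => by
    refine Fin.lastCases ?_ (fun i => ?_) i
    · exact continuous_const.congr fun t => (hgl t).symm
    · exact ((continuous_apply i).comp h'.continuous).congr fun t => (hgc i t).symm
  -- The `i`-th set is where `g i` is not minimal. These sets cover because `g` is never constant in
  -- `i`, and have no common point because a minimum is attained. Where `φ i = 0`, `g i` is minimal.
  refine ⟨fun i => ⋃ j, {t | g j t < g i t},
    fun i => isOpen_iUnion fun j => isOpen_lt (hgcont j) (hgcont i), ?_, ?_, ?_⟩
  · refine eq_univ_of_forall fun t => ?_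
    by_contra hcon
    simp only [mem_iUnion, mem_ofPred_eq, not_exists, not_lt] at hcon
    refine hne t (funext fun i => ?_)
    rw [← hgc, Pi.zero_apply, ← hgl t]
    exact le_antisymm (hcon _ _) (hcon _ _)
  · intro i t ht
    obtain ⟨j, hj⟩ := mem_iUnion.1 ht
    by_contra hti
    have hi : φ i t = 0 := by
      by_contra h
      exact hti (hφ i (subset_tsupport _ h))
    have hval : ∀ k, g k t = φ k t - φ (Fin.last _) t := fun k => by
      refine Fin.lastCases (by rw [hgl, sub_self]) (fun k => ?_) k
      rw [hgc, hEq (mem_iUnion.2 ⟨i, hi⟩)]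
      rfl
    have hj' : g j t < g i t := hj
    rw [hval, hval, hi] at hj'
    linarith [φ.nonneg j t]
  · refine eq_empty_of_forall_notMem fun t ht => ?_
    obtain ⟨i, hi⟩ := Finite.exists_min (fun i => g i t)
    obtain ⟨j, hj⟩ := mem_iUnion.1 (mem_iInter.1 ht i)
    exact absurd hj (not_lt.2 (hi j))

/-! ### Higson sublinear functions and the corona -/

/-- The oscillation of `f` on balls whose radius is a small multiple of the norm of the centre
tends to zero at infinity. For continuous `f` this amounts to being Higson sublinear. -/
def SlowlyOscillating {X Y : Type*} [MetricSpace X] [MetricSpace Y] (x₀ : X) (f : X → Y) : Prop :=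
  ∀ ε > 0, ∃ δ > 0, ∃ R : ℝ, ∀ x y, R ≤ dist x x₀ → dist x y ≤ δ * dist x x₀ →
    dist (f x) (f y) ≤ ε

theorem SlowlyOscillating.higsonSublinear {X Y : Type*} [MetricSpace X] [MetricSpace Y] {x₀ : X}
    {f : X → Y} (hf : SlowlyOscillating x₀ f) (hc : Continuous f) : HigsonSublinear x₀ f := by
  refine ⟨hc, fun s hs x y hx _ hxy => ?_⟩
  rw [Metric.tendsto_nhds]
  intro ε hε
  obtain ⟨δ, hδ, R, hR⟩ := hf (ε / 2) (by positivity)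
  -- One half of `δ` bounds the slope; the other absorbs `M` at large norm.
  obtain ⟨M, hM⟩ := hs.2 (δ / 2).toNNReal (by simpa using hδ)
  filter_upwards [hx.eventually_ge_atTop R, hx.eventually_ge_atTop (2 * M / δ)] with k h1 h2
  have h3 : dist (x k) (y k) ≤ δ / 2 * dist (x k) x₀ + M := by
    refine (hxy k).trans ?_
    have := NNReal.coe_le_coe.2 (hM (nndist (x k) x₀))
    simpa [Real.coe_toNNReal _ (half_pos hδ).le] using this
  have h4 : (M : ℝ) ≤ δ / 2 * dist (x k) x₀ := by
    rw [div_le_iff₀ hδ] at h2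
    linarith
  have h5 := hR (x k) (y k) h1 (by linarith)
  rw [Real.dist_eq, sub_zero, abs_of_nonneg dist_nonneg]
  linarith

/-- The infimum of lines with slopes `1 / (k + 1)` and intercepts `∑ j < k, r j` is 1-Lipschitz and
sublinear. At `r j`, the lines with `k ≤ j` are steep enough and those with `k > j` have intercept
at least `r j`. -/
theorem exists_asymptoticallySublinear_ge (r : ℕ → ℝ≥0) :
    ∃ s : ℝ≥0 → ℝ≥0, AsymptoticallySublinear s ∧ ∀ k, r k / (k + 1) ≤ s (r k) := by
  let M : ℕ → ℝ≥0 := fun k => ∑ j ∈ Finset.range k, r j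
  let s : ℝ≥0 → ℝ≥0 := fun t => ⨅ k : ℕ, (t / (k + 1) + M k)
  have hle : ∀ t k, s t ≤ t / (k + 1) + M k := fun t k => ciInf_le (OrderBot.bddBelow _) k
  have hstep : ∀ a b : ℝ≥0, s a ≤ s b + nndist a b := by
    intro a b
    rw [← tsub_le_iff_right]
    refine le_ciInf fun k => ?_
    rw [tsub_le_iff_right]
    refine (hle a k).trans ?_
    have h1 : a ≤ b + nndist a b := by
      rw [← NNReal.coe_le_coe, NNReal.coe_add, coe_nndist, NNReal.dist_eq]
      linarith [le_abs_self ((a : ℝ) - b)]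
    have h2 : nndist a b / (k + 1 : ℝ≥0) ≤ nndist a b := div_le_self zero_le (by simp)
    calc a / (k + 1 : ℝ≥0) + M k ≤ (b + nndist a b) / (k + 1 : ℝ≥0) + M k := by gcongr
      _ = b / (k + 1 : ℝ≥0) + M k + nndist a b / (k + 1 : ℝ≥0) := by rw [add_div]; ring
      _ ≤ b / (k + 1 : ℝ≥0) + M k + nndist a b := by gcongr
  refine ⟨s, ⟨?_, fun c hc => ?_⟩, fun j => le_ciInf fun k => ?_⟩
  · refine (LipschitzWith.of_dist_le_mul (K := 1) fun a b => ?_).continuous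
    have h1 := NNReal.coe_le_coe.2 (hstep a b)
    have h2 := NNReal.coe_le_coe.2 (hstep b a)
    rw [NNReal.coe_add, coe_nndist] at h1 h2
    rw [dist_comm b a] at h2
    rw [NNReal.coe_one, one_mul, NNReal.dist_eq, abs_le]
    constructor <;> linarith
  · obtain ⟨k, hk⟩ := exists_nat_one_div_lt (show (0 : ℝ) < c by exact_mod_cast hc)
    refine ⟨M k, fun t => (hle t k).trans ?_⟩
    have hk' : (1 : ℝ≥0) / (k + 1) ≤ c := by
      rw [← NNReal.coe_le_coe]
      push_cast
      exact hk.le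
    calc t / (k + 1 : ℝ≥0) + M k = (1 / (k + 1 : ℝ≥0)) * t + M k := by ring
      _ ≤ c * t + M k := by gcongr
  · rcases le_or_gt k j with h | h
    · calc r j / (j + 1 : ℝ≥0) ≤ r j / (k + 1 : ℝ≥0) := by gcongr
        _ ≤ _ := le_self_add
    · calc r j / (j + 1 : ℝ≥0) ≤ r j := div_le_self zero_le (by simp)
        _ ≤ M k := Finset.single_le_sum (f := r) (fun _ _ => zero_le) (Finset.mem_range.2 h)
        _ ≤ _ := le_add_self

theorem HigsonSublinear.tendsto_dist_of_dist_le {X Y : Type*} [MetricSpace X] [MetricSpace Y]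
    {x₀ : X} {f : X → Y} (hf : HigsonSublinear x₀ f) {x y : ℕ → X}
    (hx : Tendsto (fun k => dist (x k) x₀) atTop atTop)
    (hxy : ∀ k : ℕ, dist (x k) (y k) ≤ dist (x k) x₀ / (k + 1)) :
    Tendsto (fun k => dist (f (x k)) (f (y k))) atTop (𝓝 0) := by
  obtain ⟨s, hs, hsr⟩ := exists_asymptoticallySublinear_ge (fun k => nndist (x k) x₀)
  refine hf.2 s hs x y hx ?_ fun k => (hxy k).trans ?_
  · have h2 : Tendsto (fun k => dist (x k) x₀ / 2) atTop atTop := hx.atTop_div_const two_pos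
    refine tendsto_atTop_mono' _ ?_ h2
    filter_upwards [eventually_ge_atTop 1] with k hk
    have h1 : dist (x k) x₀ / (k + 1) ≤ dist (x k) x₀ / 2 := by
      have : (1 : ℝ) ≤ k := by exact_mod_cast hk
      gcongr
      linarith
    linarith [hxy k, dist_triangle (x k) (y k) x₀]
  · have := NNReal.coe_le_coe.2 (hsr k)
    push_cast at this
    exact this

section Corona

variable {X : Type*} [MetricSpace X] (x₀ : X)

theorem isCompact_higsonCompactification : IsCompact (higsonCompactification x₀) := by
  have hC : ∀ f : BoundedHigson x₀, ∃ C : ℝ, ∀ x, |f.1 x| ≤ C := fun f => f.2.2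
  choose C hC using hC
  have hK : IsCompact (univ.pi fun f : BoundedHigson x₀ => Icc (-C f) (C f)) :=
    isCompact_univ_pi fun f => isCompact_Icc
  refine hK.of_isClosed_subset isClosed_closure (closure_minimal ?_ hK.isClosed)
  rintro _ ⟨x, rfl⟩ f -
  exact abs_le.1 (hC f x)

instance : CompactSpace (higsonCompactification x₀) :=
  isCompact_iff_compactSpace.1 (isCompact_higsonCompactification x₀)

theorem continuous_higsonEval : Continuous (higsonEval x₀) :=
  continuous_pi fun f => f.2.1.1

/-- The canonical map of `X` into its Higson sublinear compactification. -/
def toCompactification (x : X) : higsonCompactification x₀ :=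
  ⟨higsonEval x₀ x, subset_closure (mem_range_self x)⟩

theorem continuous_toCompactification : Continuous (toCompactification x₀) :=
  (continuous_higsonEval x₀).subtype_mk _

/-- The tent function of height one on the unit ball around `a`. -/
def bump (a : X) : BoundedHigson x₀ :=
  ⟨fun y => max 0 (1 - dist y a), ⟨by fun_prop, by
    intro s _ x y hx hy _
    refine tendsto_const_nhds.congr' ?_
    filter_upwards [hx.eventually_ge_atTop (dist a x₀ + 1),
      hy.eventually_ge_atTop (dist a x₀ + 1)] with k h1 h2
    rw [max_eq_left, max_eq_left, dist_self]
    · linarith [dist_triangle (y k) a x₀]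
    · linarith [dist_triangle (x k) a x₀]⟩, 1, fun x => by
      rw [abs_of_nonneg (le_max_left _ _)]
      exact max_le zero_le_one (by linarith [dist_nonneg (x := x) (y := a)])⟩

theorem bump_pos_iff (a y : X) : 0 < higsonEval x₀ y (bump x₀ a) ↔ dist y a < 1 := by
  simp [higsonEval, bump]

variable {x₀}

/-- A failure yields pairs at relative distance `1 / (k + 1)` whose values stay `ε` apart. Every
bounded Higson sublinear function identifies the limits of the two sequences along an ultrafilter,
so these limits coincide, contradicting continuity. -/
theorem slowlyOscillating_comp_toCompactification {Y : Type*} [MetricSpace Y]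
    (g : C(higsonCompactification x₀, Y)) :
    SlowlyOscillating x₀ (g ∘ toCompactification x₀) := by
  by_contra hcon
  unfold SlowlyOscillating at hcon
  push Not at hcon
  obtain ⟨ε, hε, hcon⟩ := hcon
  choose x y hx hxy hd using fun k : ℕ => hcon (1 / (k + 1)) (by positivity) k
  have hlim : Tendsto (fun k => dist (x k) x₀) atTop atTop :=
    tendsto_atTop_mono hx tendsto_natCast_atTop_atTop
  let 𝒰 : Ultrafilter ℕ := hyperfilter ℕ
  have h𝒰 : (𝒰 : Filter ℕ) ≤ atTop := Nat.hyperfilter_le_atTop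
  obtain ⟨p, -, hp⟩ := isCompact_univ.ultrafilter_le_nhds
    (𝒰.map fun k => toCompactification x₀ (x k)) (by simp)
  obtain ⟨q, -, hq⟩ := isCompact_univ.ultrafilter_le_nhds
    (𝒰.map fun k => toCompactification x₀ (y k)) (by simp)
  have hp' : Tendsto (fun k => toCompactification x₀ (x k)) 𝒰 (𝓝 p) := hp
  have hq' : Tendsto (fun k => toCompactification x₀ (y k)) 𝒰 (𝓝 q) := hq
  have hpq : p = q := by
    refine Subtype.ext (funext fun f => ?_)
    have hc : Continuous fun r : higsonCompactification x₀ => r.1 f :=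
      (continuous_apply f).comp continuous_subtype_val
    have h1 := ((hc.tendsto p).comp hp').dist ((hc.tendsto q).comp hq')
    have h2 := (f.2.1.tendsto_dist_of_dist_le hlim (fun k => (hxy k).trans_eq (by ring))).mono_left
      h𝒰
    exact dist_eq_zero.1 (tendsto_nhds_unique h1 h2)
  have h1 := ((g.continuous.tendsto p).comp hp').dist ((g.continuous.tendsto q).comp hq')
  rw [hpq, dist_self] at h1
  exact absurd (ge_of_tendsto' h1 fun k => (hd k).le) (not_le.2 hε)

theorem SlowlyOscillating.exists_extension {ι : Type*} [Fintype ι] {u : X → ι → ℝ}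
    (hu : SlowlyOscillating x₀ u) (hc : Continuous u) {B : ℝ} (hB : ∀ x, ‖u x‖ ≤ B) :
    ∃ v : C(higsonCompactification x₀, ι → ℝ), ∀ x, v (toCompactification x₀ x) = u x := by
  have hi : ∀ i, HigsonSublinear x₀ fun x => u x i := fun i => by
    refine SlowlyOscillating.higsonSublinear (fun ε hε => ?_) ((continuous_apply i).comp hc)
    obtain ⟨δ, hδ, R, hR⟩ := hu ε hε
    exact ⟨δ, hδ, R, fun x y h1 h2 => (dist_le_pi_dist (u x) (u y) i).trans (hR x y h1 h2)⟩
  refine ⟨⟨fun p i => p.1 ⟨fun x => u x i, hi i, B, fun x => ?_⟩, ?_⟩, fun x => rfl⟩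
  · exact (norm_le_pi_norm (u x) i).trans (hB x)
  · exact continuous_pi fun i => (continuous_apply _).comp continuous_subtype_val

variable (x₀) [ProperSpace X]

/-- Near a point where `bump x₀ a` is positive, only points of the closed unit ball around `a`
occur. That ball is compact by properness, so its image is closed and contains the point. -/
theorem mem_corona_iff (p : BoundedHigson x₀ → ℝ) :
    p ∈ higsonCorona x₀ ↔ p ∈ higsonCompactification x₀ ∧ ∀ a, p (bump x₀ a) ≤ 0 := by
  constructor
  · rintro ⟨hp, hpr⟩
    refine ⟨hp, fun a => ?_⟩
    by_contra! hpos
    have hopen : IsOpen {q : BoundedHigson x₀ → ℝ | 0 < q (bump x₀ a)} :=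
      isOpen_lt continuous_const (continuous_apply _)
    have hcl : IsClosed (higsonEval x₀ '' Metric.closedBall a 1) :=
      ((isCompact_closedBall a 1).image (continuous_higsonEval x₀)).isClosed
    have hmem := hopen.inter_closure ⟨hpos, hp⟩
    refine hpr (image_subset_range _ _ (closure_minimal ?_ hcl hmem))
    rintro _ ⟨hq, y, rfl⟩
    exact ⟨y, Metric.mem_closedBall.2 ((bump_pos_iff x₀ a y).1 hq).le, rfl⟩
  · rintro ⟨hp, hpa⟩
    refine ⟨hp, ?_⟩
    rintro ⟨a, rfl⟩
    exact absurd (hpa a) (not_le.2 ((bump_pos_iff x₀ a a).2 (by simp)))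

theorem isClosed_higsonCorona : IsClosed (higsonCorona x₀) := by
  have : higsonCorona x₀ = higsonCompactification x₀ ∩ ⋂ a, {p | p (bump x₀ a) ≤ 0} := by
    ext p
    simp [mem_corona_iff]
  rw [this]
  exact isClosed_closure.inter
    (isClosed_iInter fun a => isClosed_le (continuous_apply _) continuous_const)

instance : CompactSpace (higsonCorona x₀) :=
  isCompact_iff_compactSpace.1
    ((isCompact_higsonCompactification x₀).of_isClosed_subset (isClosed_higsonCorona x₀)
      sdiff_subset)

/-- The inclusion of the corona into the compactification. -/
def coronaInclusion : higsonCorona x₀ → higsonCompactification x₀ :=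
  inclusion sdiff_subset

theorem isClosedEmbedding_coronaInclusion : IsClosedEmbedding (coronaInclusion x₀) :=
  Continuous.isClosedEmbedding (f := coronaInclusion x₀) (continuous_inclusion sdiff_subset)
    (inclusion_injective sdiff_subset)

variable {x₀}

/-- A neighbourhood of the corona contains all points of `X` of large norm. -/
theorem exists_radius_of_isOpen {O : Set (higsonCompactification x₀)} (hO : IsOpen O)
    (h : ∀ p, coronaInclusion x₀ p ∈ O) :
    ∃ R : ℝ, ∀ x, R ≤ dist x x₀ → toCompactification x₀ x ∈ O := by
  have hcov : Oᶜ ⊆ ⋃ a : X, {p : higsonCompactification x₀ | 0 < p.1 (bump x₀ a)} := by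
    intro p hp
    by_contra hcon
    simp only [mem_iUnion, mem_ofPred_eq, not_exists, not_lt] at hcon
    exact hp (h ⟨p.1, (mem_corona_iff x₀ _).2 ⟨p.2, hcon⟩⟩)
  obtain ⟨t, ht⟩ := hO.isClosed_compl.isCompact.elim_finite_subcover _
    (fun a => isOpen_lt continuous_const ((continuous_apply _).comp continuous_subtype_val)) hcov
  obtain ⟨R, hR⟩ := (t.finite_toSet.image fun a => dist a x₀).bddAbove
  refine ⟨R + 1, fun x hx => ?_⟩
  by_contra hxO
  obtain ⟨a, ha, hxa⟩ := mem_iUnion₂.1 (ht hxO)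
  have h1 : dist x a < 1 := (bump_pos_iff x₀ a x).1 hxa
  have h2 : dist a x₀ ≤ R := hR ⟨a, ha, rfl⟩
  linarith [dist_triangle x a x₀]

/-- A closed set which contains all points of `X` of large norm contains the corona. -/
theorem coronaInclusion_mem_of_isClosed {C : Set (higsonCompactification x₀)} (hC : IsClosed C)
    {R : ℝ} (h : ∀ x, R ≤ dist x x₀ → toCompactification x₀ x ∈ C) (p : higsonCorona x₀) :
    coronaInclusion x₀ p ∈ C := by
  have hcl : IsClosed (higsonEval x₀ '' Metric.closedBall x₀ R) :=
    ((isCompact_closedBall x₀ R).image (continuous_higsonEval x₀)).isClosed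
  have hC' : IsClosed (Subtype.val '' C : Set (BoundedHigson x₀ → ℝ)) :=
    (isClosed_closure.isClosedEmbedding_subtypeVal).isClosedMap _ hC
  have hsub : range (higsonEval x₀) ⊆ higsonEval x₀ '' Metric.closedBall x₀ R ∪
      Subtype.val '' C := by
    rintro _ ⟨x, rfl⟩
    rcases le_total (dist x x₀) R with hx | hx
    · exact Or.inl ⟨x, hx, rfl⟩
    · exact Or.inr ⟨_, h x hx, rfl⟩
  rcases closure_minimal hsub (hcl.union hC') p.2.1 with hp | ⟨q, hq, hqp⟩
  · exact absurd (image_subset_range _ _ hp) p.2.2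
  · have : coronaInclusion x₀ p = q := Subtype.ext hqp.symm
    rwa [this]

end Corona

/-! ### Lipschitz approximation -/

section Lipschitz

variable {X : Type*} [MetricSpace X]

/-- A function on `A` which is Lipschitz up to an error `M` is within `M` of a Lipschitz function
on the whole space. -/
theorem exists_lipschitz_sub_le (H M : X → ℝ) (A : Set X) {L : ℝ} (hL : 0 ≤ L)
    (h : ∀ x ∈ A, ∀ y ∈ A, H x - H y ≤ L * dist x y + M x) :
    ∃ F : X → ℝ, (∀ x y, |F x - F y| ≤ L * dist x y) ∧ ∀ x ∈ A, H x - M x ≤ F x ∧ F x ≤ H x := by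
  rcases A.eq_empty_or_nonempty with rfl | ⟨a, ha⟩
  · exact ⟨0, fun x y => by simpa using mul_nonneg hL dist_nonneg, by simp⟩
  have : Nonempty A := ⟨⟨a, ha⟩⟩
  -- The McShane formula; the error term keeps the infimum bounded below.
  let F : X → ℝ := fun x => ⨅ y : A, (H y + L * dist x y)
  have hbdd : ∀ x : X, BddBelow (range fun y : A => H y + L * dist x y) := fun x => by
    refine ⟨H a - M a - L * dist a x, ?_⟩
    rintro _ ⟨y, rfl⟩
    have h1 := h a ha y y.2
    have h2 := mul_le_mul_of_nonneg_left (dist_triangle a x y) hL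
    change _ ≤ H y + L * dist x y
    linarith
  have hstep : ∀ x y : X, F x - F y ≤ L * dist x y := fun x y => by
    rw [sub_le_comm]
    refine le_ciInf fun z => ?_
    have h1 : F x ≤ H z + L * dist x z := ciInf_le (hbdd x) z
    have h2 := mul_le_mul_of_nonneg_left (dist_triangle x y z) hL
    linarith
  refine ⟨F, fun x y => abs_sub_le_iff.2 ⟨hstep x y, dist_comm x y ▸ hstep y x⟩,
    fun x hx => ⟨le_ciInf fun y => ?_, ?_⟩⟩
  · linarith [h x hx y y.2]
  · refine (ciInf_le (hbdd x) ⟨x, hx⟩).trans ?_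
    simp

theorem exists_lipschitz_near {ι : Type*} [Fintype ι] (H : X → ι → ℝ) (M : X → ℝ) (A : Set X)
    {L : ℝ} (hL : 0 ≤ L) (hM : ∀ x ∈ A, 0 ≤ M x)
    (h : ∀ x ∈ A, ∀ y ∈ A, dist (H x) (H y) ≤ L * dist x y + M x) :
    ∃ F : X → ι → ℝ, (∀ x y, dist (F x) (F y) ≤ L * dist x y) ∧
      ∀ x ∈ A, dist (F x) (H x) ≤ M x := by
  choose F hF hFH using fun i => exists_lipschitz_sub_le (fun x => H x i) M A hL
    fun x hx y hy => (le_abs_self _).trans ((dist_le_pi_dist (H x) (H y) i).trans (h x hx y hy))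
  refine ⟨fun x i => F i x, fun x y => ?_, fun x hx => ?_⟩
  · exact (dist_pi_le_iff (mul_nonneg hL dist_nonneg)).2 fun i => hF i x y
  · refine (dist_pi_le_iff (hM x hx)).2 fun i => ?_
    obtain ⟨h1, h2⟩ := hFH i x hx
    rw [Real.dist_eq, abs_le]
    constructor <;> linarith [hM x hx]

theorem SlowlyOscillating.exists_lipschitz_near {ι : Type*} [Fintype ι] {x₀ : X} {ψ : X → ι → ℝ}
    (hψ : SlowlyOscillating x₀ ψ) {B : ℝ} (hB : ∀ x, ‖ψ x‖ ≤ B) {ε : ℝ} (hε : 0 < ε) :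
    ∃ L : ℝ, 0 ≤ L ∧ ∃ F : X → ι → ℝ, (∀ x y, dist (F x) (F y) ≤ L * dist x y) ∧
      ∃ R : ℝ, ∀ x, R ≤ dist x x₀ → dist (F x) (dist x x₀ • ψ x) ≤ ε * dist x x₀ := by
  obtain ⟨δ, hδ, R, hR⟩ := hψ ε hε
  have hB0 : 0 ≤ B := (norm_nonneg _).trans (hB x₀)
  -- In the Lipschitz constant, `B` accounts for the change of the norm and `2 * B / δ` for pairs
  -- more than `δ|x|` apart; closer pairs are covered by the oscillation bound, at cost `ε|x|`.
  obtain ⟨F, hF, hFψ⟩ := SublinearHigson.exists_lipschitz_near (fun x => dist x x₀ • ψ x)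
    (fun x => ε * dist x x₀) {x | R ≤ dist x x₀} (L := B + 2 * B / δ) (by positivity)
    (fun x _ => by positivity) (by
      intro x hx y _
      have hrep : dist x x₀ • ψ x - dist y x₀ • ψ y =
          dist x x₀ • (ψ x - ψ y) + (dist x x₀ - dist y x₀) • ψ y := by module
      have h1 : ‖(dist x x₀ - dist y x₀) • ψ y‖ ≤ dist x y * B := by
        rw [norm_smul]
        exact mul_le_mul (abs_dist_sub_le x y x₀) (hB y) (norm_nonneg _) dist_nonneg
      have h2 : ‖dist x x₀ • (ψ x - ψ y)‖ ≤ 2 * B / δ * dist x y + ε * dist x x₀ := by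
        rw [norm_smul, Real.norm_of_nonneg dist_nonneg]
        rcases le_or_gt (dist x y) (δ * dist x x₀) with h | h
        · have h3 := hR x y hx h
          rw [dist_eq_norm] at h3
          have h4 := mul_le_mul_of_nonneg_left h3 (dist_nonneg (x := x) (y := x₀))
          have h5 : 0 ≤ 2 * B / δ * dist x y := by positivity
          linarith
        · have h3 : ‖ψ x - ψ y‖ ≤ 2 * B := by linarith [norm_sub_le (ψ x) (ψ y), hB x, hB y]
          have h4 : dist x x₀ ≤ dist x y / δ := by
            rw [le_div_iff₀ hδ]
            linarith
          have h5 : dist x x₀ * ‖ψ x - ψ y‖ ≤ dist x y / δ * (2 * B) :=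
            mul_le_mul h4 h3 (norm_nonneg _) (by positivity)
          have h6 : dist x y / δ * (2 * B) = 2 * B / δ * dist x y := by ring
          have h7 : 0 ≤ ε * dist x x₀ := by positivity
          linarith
      rw [dist_eq_norm, hrep]
      linarith [norm_add_le (dist x x₀ • (ψ x - ψ y)) ((dist x x₀ - dist y x₀) • ψ y)])
  exact ⟨_, by positivity, F, hF, R, hFψ⟩

theorem continuous_of_dist_le {Y : Type*} [MetricSpace Y] {F : X → Y} {L : ℝ}
    (hF : ∀ x y, dist (F x) (F y) ≤ L * dist x y) : Continuous F :=
  (LipschitzWith.of_dist_le' hF).continuous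

/-- A Lipschitz map divided by the norm is slowly oscillating and bounded, and therefore extends
to the Higson sublinear compactification. -/
theorem exists_extension_of_lipschitz {ι : Type*} [Fintype ι] (x₀ : X) {F : X → ι → ℝ} {L : ℝ}
    (hL : 0 ≤ L) (hF : ∀ x y, dist (F x) (F y) ≤ L * dist x y) :
    ∃ B : ℝ, 0 ≤ B ∧ (∀ x, ‖(1 + dist x x₀)⁻¹ • F x‖ ≤ B) ∧
      ∃ v : C(higsonCompactification x₀, ι → ℝ),
        ∀ x, v (toCompactification x₀ x) = (1 + dist x x₀)⁻¹ • F x := by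
  have hpos : ∀ x, 0 < 1 + dist x x₀ := fun x => by positivity
  set B := ‖F x₀‖ + L with hBdef
  have hB0 : 0 ≤ B := by positivity
  have hB : ∀ x, ‖(1 + dist x x₀)⁻¹ • F x‖ ≤ B := fun x => by
    rw [norm_smul, norm_inv, Real.norm_of_nonneg (hpos x).le, inv_mul_le_iff₀ (hpos x)]
    have h1 := hF x x₀
    rw [dist_eq_norm] at h1
    have h2 : ‖F x‖ ≤ ‖F x₀‖ + ‖F x - F x₀‖ := by
      simpa using norm_add_le (F x₀) (F x - F x₀)
    have h3 : 0 ≤ ‖F x₀‖ * dist x x₀ := by positivity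
    rw [hBdef]
    linarith
  refine ⟨B, hB0, hB, SlowlyOscillating.exists_extension (fun ε hε => ?_) ?_ hB⟩
  -- The summand 1 keeps the denominator positive when `L = B = 0`.
  · refine ⟨ε / (L + B + 1), by positivity, 0, fun x y _ hxy => ?_⟩
    have hrep : (1 + dist x x₀)⁻¹ • F x - (1 + dist y x₀)⁻¹ • F y =
        (1 + dist x x₀)⁻¹ •
          ((F x - F y) + (dist y x₀ - dist x x₀) • ((1 + dist y x₀)⁻¹ • F y)) := by
      have h1 := (hpos x).ne'
      have h2 := (hpos y).ne'
      ext i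
      simp only [Pi.sub_apply, Pi.add_apply, Pi.smul_apply, smul_eq_mul]
      field_simp
      ring
    have h1 : ‖F x - F y‖ ≤ L * dist x y := by
      rw [← dist_eq_norm]
      exact hF x y
    have h2 : ‖(dist y x₀ - dist x x₀) • ((1 + dist y x₀)⁻¹ • F y)‖ ≤ dist x y * B := by
      rw [norm_smul]
      refine mul_le_mul ?_ (hB y) (norm_nonneg _) dist_nonneg
      rw [dist_comm x y]
      exact abs_dist_sub_le y x x₀
    rw [dist_eq_norm, hrep, norm_smul, norm_inv, Real.norm_of_nonneg (hpos x).le,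
      inv_mul_le_iff₀ (hpos x)]
    have h3 : (L + B) * dist x y ≤ ε * dist x x₀ := by
      have h4 : (L + B + 1) * dist x y ≤ ε * dist x x₀ := by
        have := mul_le_mul_of_nonneg_left hxy (show 0 ≤ L + B + 1 by positivity)
        rwa [← mul_assoc, mul_div_cancel₀ _ (by positivity)] at this
      linarith [dist_nonneg (x := x) (y := y)]
    have h5 := norm_add_le (F x - F y) ((dist y x₀ - dist x x₀) • ((1 + dist y x₀)⁻¹ • F y))
    linarith
  · have hcont := continuous_of_dist_le hF
    exact (Continuous.inv₀ (by fun_prop) fun x => (hpos x).ne').smul hcont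

end Lipschitz

/-! ### Truncation -/

/-- The truncation of `t` to the interval `[-a, a]`. -/
def trunc (a t : ℝ) : ℝ := max (-a) (min a t)

/-- Truncation is 1-Lipschitz jointly in bound and argument for the sup metric, so truncating at a
varying Lipschitz bound preserves Lipschitz maps. -/
theorem abs_trunc_sub_trunc_le {a b s t K : ℝ} (h1 : |a - b| ≤ K) (h2 : |s - t| ≤ K) :
    |trunc a s - trunc b t| ≤ K := by
  refine (abs_max_sub_max_le_max _ _ _ _).trans (max_le ?_ ?_)
  · rwa [neg_sub_neg, abs_sub_comm]
  · exact (abs_min_sub_min_le_max _ _ _ _).trans (max_le h1 h2)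

theorem trunc_of_abs_le {a t : ℝ} (h : |t| ≤ a) : trunc a t = t := by
  obtain ⟨h1, h2⟩ := abs_le.1 h
  rw [trunc, min_eq_right h2, max_eq_right h1]

theorem abs_trunc_le {a t : ℝ} (ha : 0 ≤ a) : |trunc a t| ≤ |t| := by
  refine abs_le.2 ⟨le_max_of_le_right (le_min ?_ (neg_abs_le t)), max_le ?_ ?_⟩
  · linarith [abs_nonneg t]
  · linarith [abs_nonneg t]
  · exact (min_le_right _ _).trans (le_abs_self t)

theorem trunc_zero (t : ℝ) : trunc 0 t = 0 := by
  simp [trunc]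

/-! ### Dimension and extension of morphisms -/

section Extension

variable {X : Type*} [MetricSpace X] [ProperSpace X] {x₀ : X} {n : ℕ}

/-- If the corona is at most `n`-dimensional, then every Lipschitz map into `ℝⁿ⁺¹` is at small
distance, relative to the norm, from a Lipschitz map which grows linearly. -/
theorem exists_growing_lipschitz_near (hdim : CoveringDimLE (higsonCorona x₀) n)
    {F : X → Fin (n + 1) → ℝ} {L : ℝ} (hL : 0 ≤ L) (hF : ∀ x y, dist (F x) (F y) ≤ L * dist x y)
    {ε : ℝ} (hε : 0 < ε) :
    ∃ (G : X → Fin (n + 1) → ℝ) (L' B c R : ℝ), 0 ≤ L' ∧ 0 ≤ B ∧ 0 < c ∧ 0 ≤ R ∧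
      (∀ x y, dist (G x) (G y) ≤ L' * dist x y) ∧
      ∀ x, R ≤ dist x x₀ → dist (G x) (F x) ≤ ε * dist x x₀ + B ∧ c * dist x x₀ ≤ ‖G x‖ := by
  obtain ⟨B, hB0, hB, u, hu⟩ := exists_extension_of_lipschitz x₀ hL hF
  have hemb := isClosedEmbedding_coronaInclusion x₀
  obtain ⟨v, hv, hv0⟩ := hdim.exists_nowhere_zero_near (by simp)
    (u.comp ⟨coronaInclusion x₀, hemb.continuous⟩) (half_pos hε)
  obtain ⟨w, hw⟩ := v.exists_extension hemb
  have hwv : ∀ p, w (coronaInclusion x₀ p) = v p := fun p => DFunLike.congr_fun hw p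
  obtain ⟨c, hc, hcv⟩ := isCompact_univ.exists_forall_le' (f := fun p => ‖v p‖)
    v.continuous.norm.continuousOn (a := 0) fun p _ => norm_pos_iff.2 (hv0 p)
  obtain ⟨R₁, hR₁⟩ := exists_radius_of_isOpen
    (O := {p | c / 2 < ‖w p‖} ∩ {p | dist (w p) (u p) < ε / 2})
    ((isOpen_lt continuous_const w.continuous.norm).inter
      (isOpen_lt (w.continuous.dist u.continuous) continuous_const)) (fun p => by
        refine ⟨?_, ?_⟩
        · have := hcv p (mem_univ _)
          change c / 2 < ‖w _‖
          rw [hwv]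
          linarith
        · change dist (w _) _ < _
          rw [hwv]
          exact hv p)
  -- The error `c / 4` preserves growth, and `ε / 2` is what the perturbation `v` left of `ε`.
  obtain ⟨L', hL', G, hG, R₂, hR₂⟩ :=
    (slowlyOscillating_comp_toCompactification w).exists_lipschitz_near
      (fun x => w.norm_coe_le_norm _) (ε := min (c / 4) (ε / 2)) (by positivity)
  refine ⟨G, L', B, c / 4, max (max R₁ R₂) 0, hL', hB0, by positivity, le_max_right _ _, hG,
    fun x hx => ?_⟩
  have hx1 : R₁ ≤ dist x x₀ := (le_max_left _ _).trans ((le_max_left _ _).trans hx)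
  have hx2 : R₂ ≤ dist x x₀ := (le_max_right _ _).trans ((le_max_left _ _).trans hx)
  obtain ⟨h1, h2⟩ := hR₁ x hx1
  change c / 2 < ‖w _‖ at h1
  change dist (w _) (u _) < ε / 2 at h2
  have h3 := hR₂ x hx2
  rw [Function.comp_apply] at h3
  have hd : 0 ≤ dist x x₀ := dist_nonneg
  have h4 : min (c / 4) (ε / 2) * dist x x₀ ≤ c / 4 * dist x x₀ := by gcongr; exact min_le_left _ _
  have h5 : min (c / 4) (ε / 2) * dist x x₀ ≤ ε / 2 * dist x x₀ := by
    gcongr; exact min_le_right _ _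
  constructor
  · have hFu : F x = (1 + dist x x₀) • u (toCompactification x₀ x) := by
      rw [hu, smul_inv_smul₀ (by positivity)]
    have h6 : dist (dist x x₀ • w (toCompactification x₀ x)) (F x) ≤
        dist x x₀ * dist (w (toCompactification x₀ x)) (u (toCompactification x₀ x)) + B := by
      have hrep : dist x x₀ • w (toCompactification x₀ x) - F x =
          dist x x₀ • (w (toCompactification x₀ x) - u (toCompactification x₀ x)) -
            u (toCompactification x₀ x) := by
        rw [hFu]
        module
      have h7 : ‖u (toCompactification x₀ x)‖ ≤ B := by
        rw [hu]
        exact hB x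
      rw [dist_eq_norm, hrep, dist_eq_norm]
      refine (norm_sub_le _ _).trans (add_le_add ?_ h7)
      rw [norm_smul, Real.norm_of_nonneg hd]
    have h7 := mul_le_mul_of_nonneg_left h2.le hd
    linarith [dist_triangle (G x) (dist x x₀ • w (toCompactification x₀ x)) (F x)]
  · have h6 : dist x x₀ * (c / 2) ≤ ‖dist x x₀ • w (toCompactification x₀ x)‖ := by
      rw [norm_smul, Real.norm_of_nonneg hd]
      exact mul_le_mul_of_nonneg_left h1.le hd
    rw [dist_eq_norm] at h3
    have h7 := norm_sub_norm_le (dist x x₀ • w (toCompactification x₀ x)) (G x)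
    rw [norm_sub_rev] at h7
    linarith

theorem exists_morphism_extension_of_nonempty (hdim : CoveringDimLE (higsonCorona x₀) n)
    {A : Set X} (hA : A.Nonempty) {f : X → Fin (n + 1) → ℝ} (hf : IsMorphismOn x₀ 0 f A) :
    ∃ g : X → Fin (n + 1) → ℝ, IsMorphismOn x₀ 0 g univ ∧ EqOn g f A := by
  classical
  obtain ⟨⟨L, M, hL, hM, hf⟩, b, c, hb, hc, hfc⟩ := hf
  obtain ⟨F, hF, hFf⟩ := exists_lipschitz_near f (fun _ => M) A hL (fun _ _ => hM) hf
  -- Where truncation is active, some `a ∈ A` has `k * dist x a < ε|x| + B`. With `k = L + c`,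
  -- growth of `f` at `a` gives `‖F x‖ ≥ (c - ε)|x|` up to constants; subtracting `‖T x‖ ≤ ε|x| + B`
  -- leaves slope `c / 2`.
  set ε := c / 4 with hε
  obtain ⟨G, L', B, c', R, hL', hB, hc', hR, hG, hGR⟩ :=
    exists_growing_lipschitz_near hdim hL hF (ε := ε) (by positivity)
  set k := L + c with hk
  have hkpos : 0 < k := by positivity
  let r : X → ℝ := fun x => k * Metric.infDist x A
  have hr0 : ∀ x, 0 ≤ r x := fun x => mul_nonneg hkpos.le Metric.infDist_nonneg
  let T : X → Fin (n + 1) → ℝ := fun x i => trunc (r x) (G x i - F x i)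
  have hTlip : ∀ x y, dist (T x) (T y) ≤ (k + L' + L) * dist x y := by
    intro x y
    have hd : 0 ≤ dist x y := dist_nonneg
    refine (dist_pi_le_iff (by positivity)).2 fun i => abs_trunc_sub_trunc_le ?_ ?_
    · have h1 : |Metric.infDist x A - Metric.infDist y A| ≤ dist x y := by
        refine abs_sub_le_iff.2 ⟨?_, ?_⟩
        · linarith [Metric.infDist_le_infDist_add_dist (s := A) (x := x) (y := y)]
        · linarith [Metric.infDist_le_infDist_add_dist (s := A) (x := y) (y := x), dist_comm x y]
      change |k * _ - k * _| ≤ _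
      rw [← mul_sub, abs_mul, abs_of_pos hkpos]
      have h2 := mul_le_mul_of_nonneg_left h1 hkpos.le
      have h3 : 0 ≤ (L' + L) * dist x y := by positivity
      linarith
    · have h1 := (dist_le_pi_dist (G x) (G y) i).trans (hG x y)
      have h2 := (dist_le_pi_dist (F x) (F y) i).trans (hF x y)
      rw [Real.dist_eq] at h1 h2
      have h3 := abs_sub (G x i - G y i) (F x i - F y i)
      rw [show G x i - F x i - (G y i - F y i) = G x i - G y i - (F x i - F y i) by ring]
      have h4 : 0 ≤ k * dist x y := by positivity
      linarith
  have hTA : ∀ x ∈ A, T x = 0 := fun x hx => by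
    ext i
    change trunc (k * Metric.infDist x A) _ = 0
    rw [Metric.infDist_zero_of_mem hx, mul_zero, trunc_zero]
  have hlow : ∀ x, R ≤ dist x x₀ →
      min (c / 2) c' * dist x x₀ - (2 * B + b + M) ≤ ‖F x + T x‖ := by
    intro x hx
    obtain ⟨h1, h2⟩ := hGR x hx
    have hd : 0 ≤ dist x x₀ := dist_nonneg
    have hmin1 : min (c / 2) c' * dist x x₀ ≤ c / 2 * dist x x₀ := by
      gcongr; exact min_le_left _ _
    have hmin2 : min (c / 2) c' * dist x x₀ ≤ c' * dist x x₀ := by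
      gcongr; exact min_le_right _ _
    by_cases hall : ∀ i, |G x i - F x i| ≤ r x
    · have : F x + T x = G x := by
        ext i
        change F x i + trunc (r x) (G x i - F x i) = G x i
        rw [trunc_of_abs_le (hall i)]
        ring
      rw [this]
      linarith
    · push Not at hall
      obtain ⟨i, hi⟩ := hall
      have h3 : r x < ε * dist x x₀ + B :=
        hi.trans_le ((dist_le_pi_dist (G x) (F x) i).trans h1)
      obtain ⟨a, ha, hxa⟩ := (Metric.infDist_lt_iff hA).1 ((lt_div_iff₀' hkpos).2 h3)
      rw [lt_div_iff₀' hkpos] at hxa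
      have h4 : ‖T x‖ ≤ ε * dist x x₀ + B :=
        (pi_norm_le_iff_of_nonneg (by positivity)).2 fun j =>
          (abs_trunc_le (hr0 x)).trans ((dist_le_pi_dist (G x) (F x) j).trans h1)
      have h5 := hfc a ha
      rw [dist_zero_right] at h5
      have h6 : ‖f a‖ ≤ ‖F x‖ + L * dist x a + M := by
        have h7 := hFf a ha
        have h8 := hF x a
        rw [dist_comm (F x), dist_eq_norm] at h8
        rw [dist_comm, dist_eq_norm] at h7
        linarith [norm_sub_norm_le (f a) (F a), norm_sub_norm_le (F a) (F x)]
      have h7 : c * dist x x₀ ≤ c * dist x a + c * dist a x₀ := by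
        rw [← mul_add]
        exact mul_le_mul_of_nonneg_left (dist_triangle x a x₀) hc.le
      have h8 : ‖F x‖ - ‖T x‖ ≤ ‖F x + T x‖ := by
        have := norm_sub_norm_le (F x) (-T x)
        rwa [norm_neg, sub_neg_eq_add] at this
      rw [hk, add_mul] at hxa
      have h9 : ε * dist x x₀ = c * dist x x₀ / 4 := by rw [hε]; ring
      linarith
  -- Morphisms need not be continuous, so restoring `f` on `A` costs only the additive error `M`.
  let g : X → Fin (n + 1) → ℝ := fun x => if x ∈ A then f x else F x + T x
  have hgd : ∀ x, dist (g x) (F x + T x) ≤ M := by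
    intro x
    by_cases hx : x ∈ A
    · simp only [g, if_pos hx, hTA x hx, add_zero]
      rw [dist_comm]
      exact hFf x hx
    · simpa only [g, if_neg hx, dist_self] using hM
  refine ⟨g, ⟨⟨L + (k + L' + L), 2 * M, by positivity, by positivity, fun x _ y _ => ?_⟩,
    2 * B + b + 2 * M + min (c / 2) c' * R, min (c / 2) c', by positivity, by positivity,
    fun x _ => ?_⟩, fun x hx => if_pos hx⟩
  · have h1 : dist (F x + T x) (F y + T y) ≤ dist (F x) (F y) + dist (T x) (T y) :=
      dist_add_add_le _ _ _ _
    have h2 := dist_triangle4 (g x) (F x + T x) (F y + T y) (g y)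
    have h3 := hgd y
    rw [dist_comm] at h3
    linarith [hgd x, hF x y, hTlip x y]
  · rw [dist_zero_right]
    have hmin : 0 < min (c / 2) c' := by positivity
    rcases le_total R (dist x x₀) with hx | hx
    · have h1 := hgd x
      rw [dist_comm, dist_eq_norm] at h1
      have h2 : 0 ≤ min (c / 2) c' * R := by positivity
      linarith [hlow x hx, norm_sub_norm_le (F x + T x) (g x)]
    · have h1 := mul_le_mul_of_nonneg_left hx hmin.le
      linarith [norm_nonneg (g x)]

theorem isAbsoluteExtensor_of_coveringDimLE (hdim : CoveringDimLE (higsonCorona x₀) n) :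
    IsAbsoluteExtensor x₀ (0 : Fin (n + 1) → ℝ) := by
  intro A _ f hf
  rcases A.eq_empty_or_nonempty with rfl | hA
  -- `Metric.infDist` to the empty set is 0, which would truncate everything away; a one-point set
  -- serves instead.
  · obtain ⟨g, hg, -⟩ := exists_morphism_extension_of_nonempty (A := {x₀}) (f := fun _ => 0) hdim
      (singleton_nonempty x₀) ⟨⟨0, 0, le_rfl, le_rfl, by simp⟩, 1, 1, one_pos, one_pos, by simp⟩
    exact ⟨g, hg, eqOn_empty g f⟩
  · exact exists_morphism_extension_of_nonempty hdim hA hf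

theorem coveringDimLE_of_isAbsoluteExtensor
    (hext : IsAbsoluteExtensor x₀ (0 : Fin (n + 1) → ℝ)) :
    CoveringDimLE (higsonCorona x₀) n := by
  refine coveringDimLE_of_extension fun h A hA hh => ?_
  have hemb := isClosedEmbedding_coronaInclusion x₀
  obtain ⟨w, hw⟩ := h.exists_extension hemb
  have hwh : ∀ p, w (coronaInclusion x₀ p) = h p := fun p => DFunLike.congr_fun hw p
  obtain ⟨c₃, hc₃, hcA⟩ := hA.isCompact.exists_forall_le' (f := fun p => ‖h p‖)
    h.continuous.norm.continuousOn (a := 0) fun p hp => norm_pos_iff.2 (hh p hp)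
  -- Three levels are needed: `‖h‖ ≥ 3c` on `A`, the morphism lives where `‖w‖ ≥ 2c`, and the
  -- approximation there is accurate to `c`.
  obtain ⟨c, hc, rfl⟩ : ∃ c : ℝ, 0 < c ∧ 3 * c = c₃ := ⟨c₃ / 3, by positivity, by ring⟩
  obtain ⟨L, hL, G, hG, R, hR⟩ :=
    (slowlyOscillating_comp_toCompactification w).exists_lipschitz_near
      (fun x => w.norm_coe_le_norm _) (half_pos hc)
  have hwc : Continuous fun x => ‖w (toCompactification x₀ x)‖ :=
    (w.continuous.comp (continuous_toCompactification x₀)).norm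
  obtain ⟨g, ⟨⟨l, M, hl, hM, hg⟩, b, c', hb, hc', hgc⟩, hgG⟩ :=
    hext ({x | R ≤ dist x x₀} ∩ {x | 2 * c ≤ ‖w (toCompactification x₀ x)‖})
      ((isClosed_le continuous_const (continuous_id.dist continuous_const)).inter
        (isClosed_le continuous_const hwc)) G
      ⟨⟨L, 0, hL, le_rfl, fun x _ y _ => by simpa using hG x y⟩, 1, c, one_pos, hc, fun x hx => by
        have h1 := hR x hx.1
        rw [Function.comp_apply, dist_comm, dist_eq_norm] at h1
        have h2 := norm_sub_norm_le (dist x x₀ • w (toCompactification x₀ x)) (G x)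
        have h3 := mul_le_mul_of_nonneg_left hx.2 (dist_nonneg (x := x) (y := x₀))
        rw [norm_smul, Real.norm_of_nonneg dist_nonneg] at h2
        rw [dist_zero_right]
        have h4 : 0 ≤ c * dist x x₀ := by positivity
        linarith⟩
  obtain ⟨F, hF, hFg⟩ := exists_lipschitz_near g (fun _ => M) univ hl (fun _ _ => hM) hg
  obtain ⟨-, -, -, v, hv⟩ := exists_extension_of_lipschitz x₀ hl hF
  have hvlow : ∀ p, c' / 2 ≤ ‖v (coronaInclusion x₀ p)‖ := by
    refine coronaInclusion_mem_of_isClosed (C := {p | c' / 2 ≤ ‖v p‖})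
      (R := 2 * (b + M) / c' + 1) (isClosed_le continuous_const v.continuous.norm) fun x hx => ?_
    change _ ≤ ‖v _‖
    have hpos : 0 < 1 + dist x x₀ := by positivity
    rw [hv, norm_smul, norm_inv, Real.norm_of_nonneg hpos.le, le_inv_mul_iff₀ hpos]
    have h1 := hgc x (mem_univ _)
    have h2 := hFg x (mem_univ _)
    rw [dist_zero_right] at h1
    rw [dist_comm, dist_eq_norm] at h2
    have h3 : 2 * (b + M) ≤ c' * (dist x x₀ - 1) := by
      rw [← div_le_iff₀' hc']
      linarith
    linarith [norm_sub_norm_le (g x) (F x)]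
  -- Where `‖w‖ ≥ 2c`, `g` equals `G`, so `F` is close to `|x| w`. The alternative is a closed
  -- condition and passes to the corona.
  have hvw : ∀ p, ‖h p‖ ≤ 2 * c ∨ dist (v (coronaInclusion x₀ p)) (h p) ≤ c := by
    intro p
    rw [← hwh]
    have hpos : ∀ x : X, 0 < 1 + dist x x₀ := fun x => by positivity
    refine coronaInclusion_mem_of_isClosed (C := {p | ‖w p‖ ≤ 2 * c} ∪ {p | dist (v p) (w p) ≤ c})
      (R := max R (2 * (M + ‖w‖) / c)) ((isClosed_le w.continuous.norm continuous_const).union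
        (isClosed_le (v.continuous.dist w.continuous) continuous_const)) (fun x hx => ?_) p
    rcases le_total ‖w (toCompactification x₀ x)‖ (2 * c) with h2c | h2c
    · exact Or.inl h2c
    · right
      change dist (v _) (w _) ≤ c
      have hxR : R ≤ dist x x₀ := (le_max_left _ _).trans hx
      have h1 := hFg x (mem_univ _)
      rw [hgG ⟨hxR, h2c⟩] at h1
      have h2 := hR x hxR
      rw [Function.comp_apply] at h2
      have h3 := w.norm_coe_le_norm (toCompactification x₀ x)
      have h4 : 2 * (M + ‖w‖) ≤ c * dist x x₀ := by
        rw [← div_le_iff₀' hc]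
        exact (le_max_right _ _).trans hx
      have hrep : (1 + dist x x₀)⁻¹ • F x - w (toCompactification x₀ x) =
          (1 + dist x x₀)⁻¹ • ((F x - dist x x₀ • w (toCompactification x₀ x)) -
            w (toCompactification x₀ x)) := by
        rw [eq_inv_smul_iff₀ (hpos x).ne', smul_sub, smul_inv_smul₀ (hpos x).ne']
        module
      rw [hv, dist_eq_norm, hrep, norm_smul, norm_inv, Real.norm_of_nonneg (hpos x).le,
        inv_mul_le_iff₀ (hpos x)]
      have h5 := dist_triangle (F x) (G x) (dist x x₀ • w (toCompactification x₀ x))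
      rw [dist_eq_norm (F x) (dist x x₀ • _)] at h5
      linarith [norm_sub_le (F x - dist x x₀ • w (toCompactification x₀ x))
        (w (toCompactification x₀ x))]
  -- The glued map is `v` where `‖h‖ ≤ 2c` and `h` where `‖h‖ ≥ 3c`. In between, `v` is within `c`
  -- of `h`, so a zero would force `‖h‖ ≤ c`.
  let τ : C(higsonCorona x₀, ℝ) := ⟨fun p => max 0 (min 1 ((‖h p‖ - 2 * c) / c)), by fun_prop⟩
  let vν : C(higsonCorona x₀, Fin (n + 1) → ℝ) := v.comp ⟨coronaInclusion x₀, hemb.continuous⟩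
  have hτ0 : ∀ p, 0 ≤ τ p := fun p => le_max_left _ _
  have hτ1 : ∀ p, τ p ≤ 1 := fun p => max_le zero_le_one (min_le_left _ _)
  refine ⟨⟨fun p => vν p + τ p • (h p - vν p), by fun_prop⟩, fun p hp => ?_, fun p h0 => ?_⟩
  · have h1 : τ p = 1 := by
      refine le_antisymm (hτ1 p) (le_max_of_le_right (le_min le_rfl ?_))
      rw [le_div_iff₀ hc]
      have := hcA p hp
      linarith
    change vν p + τ p • (h p - vν p) = h p
    rw [h1, one_smul, add_sub_cancel]
  · change vν p + τ p • (h p - vν p) = 0 at h0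
    rcases le_or_gt ‖h p‖ (2 * c) with h1 | h1
    · have h2 : τ p = 0 := by
        refine max_eq_left ((min_le_right _ _).trans ?_)
        exact div_nonpos_of_nonpos_of_nonneg (by linarith) hc.le
      rw [h2, zero_smul, add_zero] at h0
      have h3 : c' / 2 ≤ ‖vν p‖ := hvlow p
      rw [h0, norm_zero] at h3
      linarith
    · have h2 : ‖vν p - h p‖ ≤ c := by
        rw [← dist_eq_norm]
        exact (hvw p).resolve_left (not_le.2 h1)
      have h3 : h p = (τ p - 1) • (vν p - h p) := by
        rw [← sub_eq_zero, ← h0]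
        module
      have h4 : ‖h p‖ ≤ 1 * c := by
        rw [h3, norm_smul]
        refine mul_le_mul ?_ h2 (norm_nonneg _) zero_le_one
        rw [Real.norm_eq_abs, abs_le]
        constructor <;> linarith [hτ0 p, hτ1 p]
      linarith

end Extension

/-! ### The main theorem -/

theorem IsMorphismOn.comp_bilipschitz {X Y Z : Type*} [MetricSpace X] [MetricSpace Y]
    [MetricSpace Z] {x₀ : X} {y₀ : Y} {f : X → Y} {A : Set X} (hf : IsMorphismOn x₀ y₀ f A)
    {e : Y → Z} {K K' : ℝ≥0} (he : LipschitzWith K e) (he' : AntilipschitzWith K' e) :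
    IsMorphismOn x₀ (e y₀) (e ∘ f) A := by
  obtain ⟨⟨l, M, hl, hM, h⟩, b, c, hb, hc, hbc⟩ := hf
  refine ⟨⟨K * l, K * M, by positivity, by positivity, fun x hx y hy => ?_⟩, b / (K' + 1),
    c / (K' + 1), by positivity, by positivity, fun x hx => ?_⟩
  · have h1 := mul_le_mul_of_nonneg_left (h x hx y hy) K.coe_nonneg
    have h2 := he.dist_le_mul (f x) (f y)
    simp only [Function.comp_apply]
    linarith
  · have h1 := he'.le_mul_dist (f x) y₀
    have h2 : c / (K' + 1) * dist x x₀ - b / (K' + 1) = (c * dist x x₀ - b) / (K' + 1) := by ring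
    rw [h2, div_le_iff₀ (by positivity)]
    have h3 := hbc x hx
    have h4 : 0 ≤ dist (e (f x)) (e y₀) := dist_nonneg
    simp only [Function.comp_apply]
    linarith

theorem IsAbsoluteExtensor.of_bilipschitz {X Y Z : Type*} [MetricSpace X] [MetricSpace Y]
    [MetricSpace Z] {x₀ : X} {y₀ : Y} (h : IsAbsoluteExtensor x₀ y₀) (e : Y ≃ Z) {K K' : ℝ≥0}
    (he : LipschitzWith K e) (he' : LipschitzWith K' e.symm) : IsAbsoluteExtensor x₀ (e y₀) := by
  intro A hA f hf
  have hf' := hf.comp_bilipschitz he' (he.to_rightInverse e.right_inv)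
  rw [e.symm_apply_apply] at hf'
  obtain ⟨g, hg, hgf⟩ := h A hA _ hf'
  refine ⟨e ∘ g, hg.comp_bilipschitz he (he'.to_rightInverse e.left_inv), fun x hx => ?_⟩
  rw [Function.comp_apply, hgf hx, Function.comp_apply, e.apply_symm_apply]

/-- The sup and Euclidean norms are bilipschitz equivalent, which allows coordinatewise arguments in
the sup norm. -/
theorem isAbsoluteExtensor_euclidean_iff {X : Type*} [MetricSpace X] (x₀ : X) (n : ℕ) :
    IsAbsoluteExtensor x₀ (0 : EuclideanSpace ℝ (Fin n)) ↔
      IsAbsoluteExtensor x₀ (0 : Fin n → ℝ) :=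
  ⟨fun h => h.of_bilipschitz (WithLp.equiv 2 (Fin n → ℝ)) (PiLp.lipschitzWith_ofLp 2 _)
      (PiLp.lipschitzWith_toLp 2 _),
    fun h => h.of_bilipschitz (WithLp.equiv 2 (Fin n → ℝ)).symm (PiLp.lipschitzWith_toLp 2 _)
      (PiLp.lipschitzWith_ofLp 2 _)⟩

theorem coveringDimLE_iff_isAbsoluteExtensor {X : Type*} [MetricSpace X] [ProperSpace X] (x₀ : X)
    (n : ℕ) : CoveringDimLE (higsonCorona x₀) n ↔
      IsAbsoluteExtensor x₀ (0 : EuclideanSpace ℝ (Fin (n + 1))) :=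
  (Iff.intro isAbsoluteExtensor_of_coveringDimLE coveringDimLE_of_isAbsoluteExtensor).trans
    (isAbsoluteExtensor_euclidean_iff x₀ (n + 1)).symm

theorem nonempty_higsonCorona {X : Type*} [MetricSpace X] [ProperSpace X] (x₀ : X)
    (hX : ¬ Bornology.IsBounded (univ : Set X)) : Nonempty (higsonCorona x₀) := by
  by_contra hempty
  rw [not_nonempty_iff] at hempty
  -- If the corona is empty, the empty set is a neighbourhood of it.
  obtain ⟨R, hR⟩ := exists_radius_of_isOpen (x₀ := x₀) isOpen_empty fun p => hempty.elim p
  exact hX (Metric.isBounded_closedBall.subset (s := univ) (t := Metric.closedBall x₀ R)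
    fun x _ => le_of_not_ge (hR x))

end SublinearHigson

theorem mainTheorem4 {X : Type*} [MetricSpace X] [ProperSpace X] (x₀ : X) :
    (∀ n : ℕ, SublinearHigson.coveringDim (SublinearHigson.higsonCorona x₀) ≤ (n : WithBot ℕ∞) ↔
      SublinearHigson.IsAbsoluteExtensor x₀ (0 : EuclideanSpace ℝ (Fin (n + 1)))) ∧
    (¬ Bornology.IsBounded (Set.univ : Set X) →
      SublinearHigson.coveringDim (SublinearHigson.higsonCorona x₀) =
        sInf {d : WithBot ℕ∞ | ∃ n : ℕ, d = (n : WithBot ℕ∞) ∧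
          SublinearHigson.IsAbsoluteExtensor x₀ (0 : EuclideanSpace ℝ (Fin (n + 1)))}) := by
  refine ⟨fun n => (SublinearHigson.coveringDim_le_iff n).trans
    (SublinearHigson.coveringDimLE_iff_isAbsoluteExtensor x₀ n), fun hX => ?_⟩
  -- Nonemptiness rules out the value `⊥`, which the infimum over natural numbers never takes.
  have := SublinearHigson.nonempty_higsonCorona x₀ hX
  rw [SublinearHigson.coveringDim, if_neg (not_isEmpty_of_nonempty _)]
  simp only [SublinearHigson.coveringDimLE_iff_isAbsoluteExtensor x₀]
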